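/- Let $X$ be a compact metric space, let $\mathcal P(X)$ be the set of Borel probability measures on $X$ with the topology of weak convergence (convergence of integrals of all continuous functions), and let $c\colon X\times X\to\mathbb R$ be symmetric and Lipschitz continuous. For $\mu,\nu\in\mathcal P(X)$ let $\Pi(\mu,\nu)$ be the set of probability measures on $X\times X$ with marginals $\mu$ and $\nu$, and for $\varepsilon>0$ put $$\mathrm{OT}(\mu,\nu)=\inf_{\pi\in\Pi(\mu,\nu)}\int c\,d\pi,\qquad \mathrm{OT}_\varepsilon(\mu,\nu)=\inf_{\pi\in\Pi(\mu,\nu)}\Big\{\int c\,d\pi+\varepsilon\,\mathrm{KL}(\pi,\mu\otimes\nu)\Big\},\qquad \mathrm{OT}_\infty(\mu,\nu)=\int c\,d(\mu\otimes\nu),$$ where $\mathrm{KL}(\pi,\rho)=\int\log\frac{d\pi}{d\rho}\,d\pi$ if $\pi\ll\rho$ and $\mathrm{KL}(\pi,\rho)=+\infty$ otherwise. For $\varepsilon\in(0,\infty]$ put $$S_\varepsilon(\mu,\nu)=\mathrm{OT}_\varepsilon(\mu,\nu)-\tfrac12\mathrm{OT}_\varepsilon(\mu,\mu)-\tfrac12\mathrm{OT}_\varepsilon(\nu,\nu).$$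 A sequence of functionals $F_n\colon\mathcal P(X)\to(-\infty,+\infty]$ $\Gamma$-converges to $F$ if for every $\mu\in\mathcal P(X)$: (a) $F(\mu)\le\liminf_{n\to\infty} F_n(\mu_n)$ whenever $\mu_n\to\mu$ weakly; and (b) there are $\mu_n\to\mu$ weakly with $\limsup_{n\to\infty} F_n(\mu_n)\le F(\mu)$. Fix $\nu\in\mathcal P(X)$. Then: 1. For every sequence $\varepsilon_n>0$ with $\varepsilon_n\to\infty$, the functionals $S_{\varepsilon_n}(\cdot,\nu)$ $\Gamma$-converge to $S_\infty(\cdot,\nu)$. 2. If in addition $c\ge 0$ and $c(x,x)=0$ for all $x\in X$, then for every sequence $\varepsilon_n>0$ with $\varepsilon_n\to0$, the functionals $S_{\varepsilon_n}(\cdot,\nu)$ $\Gamma$-converge to $\mathrm{OT}(\cdot,\nu)$. -/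

import Mathlib

open MeasureTheory Filter Topology

noncomputable section

namespace SinkhornGamma

/-- A sequence of extended-real functionals `F n` on a topological space `P`
`Γ`-converges to `G` (sequential definition): for every point `p`,
(i) `G p ≤ liminf F n (q n)` whenever `q n → p`, and
(ii) there is a sequence `q n → p` with `limsup F n (q n) ≤ G p`. -/
def GammaConverges {P : Type*} [TopologicalSpace P] (F : ℕ → P → EReal) (G : P → EReal) : Prop :=
  ∀ p : P,
    (∀ q : ℕ → P, Tendsto q atTop (𝓝 p) → G p ≤ liminf (fun n => F n (q n)) atTop) ∧
    (∃ q : ℕ → P, Tendsto q atTop (𝓝 p) ∧ limsup (fun n => F n (q n)) atTop ≤ G p)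

variable {X : Type*} [MeasurableSpace X]

/-- The set `Π(μ, ν)` of joint probability measures on `X × X` with marginals `μ` and `ν`. -/
def couplings (μ ν : ProbabilityMeasure X) : Set (ProbabilityMeasure (X × X)) :=
  {π | (π : Measure (X × X)).map Prod.fst = (μ : Measure X) ∧
       (π : Measure (X × X)).map Prod.snd = (ν : Measure X)}

/-- Optimal transport: the infimum of `∫ c dπ` over `π ∈ Π(μ, ν)`. -/
def OT (c : X × X → ℝ) (μ ν : ProbabilityMeasure X) : EReal :=
  ⨅ π ∈ couplings μ ν, ((∫ z, c z ∂(π : Measure (X × X)) : ℝ) : EReal)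

/-- Regularized optimal transport, for a parameter `ε > 0`: the infimum of
`∫ c dπ + ε KL(π, μ ⊗ ν)` over `π ∈ Π(μ, ν)`, where `KL` takes values in `[0, ∞]`. -/
def OTeps (c : X × X → ℝ) (ε : ℝ) (μ ν : ProbabilityMeasure X) : EReal :=
  ⨅ π ∈ couplings μ ν,
    (((∫ z, c z ∂(π : Measure (X × X)) : ℝ) : EReal) +
      (ε : EReal) * ((InformationTheory.klDiv (π : Measure (X × X))
        ((μ : Measure X).prod (ν : Measure X)) : ENNReal) : EReal))

/-- The limiting functional `OT_∞(μ, ν) = ∫ c d(μ ⊗ ν)`. -/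
def OTinf (c : X × X → ℝ) (μ ν : ProbabilityMeasure X) : EReal :=
  ((∫ z, c z ∂((μ : Measure X).prod (ν : Measure X)) : ℝ) : EReal)

/-- The Sinkhorn divergence `S_ε`, for a parameter `ε > 0`. -/
def Seps (c : X × X → ℝ) (ε : ℝ) (μ ν : ProbabilityMeasure X) : EReal :=
  OTeps c ε μ ν - ((1 / 2 : ℝ) : EReal) * OTeps c ε μ μ - ((1 / 2 : ℝ) : EReal) * OTeps c ε ν ν

/-- The divergence `S_∞`, built from `OT_∞` in the same way. -/
def Sinf (c : X × X → ℝ) (μ ν : ProbabilityMeasure X) : EReal :=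
  OTinf c μ ν - ((1 / 2 : ℝ) : EReal) * OTinf c μ μ - ((1 / 2 : ℝ) : EReal) * OTinf c ν ν

end SinkhornGamma

end

/-! In both regimes the estimates on `OTeps` are uniform in the marginals, so the self-terms, which
vary along the sequence, cause no trouble and constant sequences serve as recovery sequences.

For large ε, the product plan bounds `OTeps` above by `OTinf`, and Fenchel duality for the entropy
bounds it below by `OTinf` minus C²/ε (`OTinf_sub_le_OTeps`). As μ ⊗ ν is weakly continuous in its
factors, `Seps` converges along every weakly convergent sequence.

For small ε, cut X into N small cells and replace a plan by the one with the same block masses that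
is proportional to μ ⊗ ν on each block. The cost moves little because c is Lipschitz, and the
entropy is at most N² + 1 for all marginals (`exists_forall_OTeps_le`). Applied to the diagonal
plan, this makes the self-terms uniformly small; lower semicontinuity of `OT` gives the liminf
inequality. The limsup inequality drops the nonnegative self-terms. -/

namespace SinkhornGamma

open scoped ENNReal

/-! ### Block approximation of plans -/

section BlockApproximation

variable {X ι : Type*} [MeasurableSpace X]

/-- The mass that `π` gives to the block indexed by `w`, relative to the mass given to it by
`μ ⊗ ν`, where `a` is the map sending a point to the index of its cell. -/
noncomputable def blockRatio (a : X → ι) (μ ν : Measure X) (π : Measure (X × X)) (w : ι × ι) :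
    ℝ≥0∞ :=
  π ((a ⁻¹' {w.1}) ×ˢ (a ⁻¹' {w.2})) / (μ (a ⁻¹' {w.1}) * ν (a ⁻¹' {w.2}))

/-- The block approximation of `π`: the measure that agrees with `π` on blocks and is proportional
to `μ ⊗ ν` on each block. -/
noncomputable def blockPlan (a : X → ι) (μ ν : Measure X) (π : Measure (X × X)) :
    Measure (X × X) :=
  (μ.prod ν).withDensity fun z => blockRatio a μ ν π (a z.1, a z.2)

variable {a : X → ι} {μ ν : Measure X} {π : Measure (X × X)}

lemma blockRatio_swap (w : ι × ι) :
    blockRatio a ν μ (π.map Prod.swap) w.swap = blockRatio a μ ν π w := by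
  have : (π.map Prod.swap) ((a ⁻¹' {w.2}) ×ˢ (a ⁻¹' {w.1})) =
      π ((a ⁻¹' {w.1}) ×ˢ (a ⁻¹' {w.2})) := by
    rw [← Set.preimage_swap_prod]
    exact MeasurableEquiv.prodComm.map_apply _
  simp only [blockRatio, Prod.fst_swap, Prod.snd_swap, this, mul_comm]

variable [MeasurableSpace ι] [MeasurableSingletonClass ι]

lemma measure_prod_le_fst (ha : Measurable a)
    (h1 : π.map Prod.fst = μ) (i : ι) (s : Set X) : π ((a ⁻¹' {i}) ×ˢ s) ≤ μ (a ⁻¹' {i}) := by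
  rw [← h1, Measure.map_apply measurable_fst (ha (measurableSet_singleton i))]
  exact measure_mono fun z hz => hz.1

lemma measure_prod_le_snd (ha : Measurable a)
    (h2 : π.map Prod.snd = ν) (s : Set X) (j : ι) : π (s ×ˢ (a ⁻¹' {j})) ≤ ν (a ⁻¹' {j}) := by
  rw [← h2, Measure.map_apply measurable_snd (ha (measurableSet_singleton j))]
  exact measure_mono fun z hz => hz.2

/-- If the denominator vanishes, so does the π-mass of the block, since each marginal dominates it.
-/
lemma blockRatio_mul [IsFiniteMeasure μ] [IsFiniteMeasure ν] (ha : Measurable a)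
    (h1 : π.map Prod.fst = μ) (h2 : π.map Prod.snd = ν) (w : ι × ι) :
    blockRatio a μ ν π w * (μ (a ⁻¹' {w.1}) * ν (a ⁻¹' {w.2})) =
      π ((a ⁻¹' {w.1}) ×ˢ (a ⁻¹' {w.2})) := by
  refine ENNReal.div_mul_cancel' (fun h => ?_)
    (fun h => absurd h (ENNReal.mul_ne_top (measure_ne_top _ _) (measure_ne_top _ _)))
  rcases mul_eq_zero.1 h with h | h
  · exact le_antisymm ((measure_prod_le_fst ha h1 _ _).trans h.le) zero_le
  · exact le_antisymm ((measure_prod_le_snd ha h2 _ _).trans h.le) zero_le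

variable [Fintype ι]

lemma measurable_blockRatio_comp (ha : Measurable a) (μ ν : Measure X) (π : Measure (X × X)) :
    Measurable fun z : X × X => blockRatio a μ ν π (a z.1, a z.2) :=
  (Measurable.of_discrete (f := blockRatio a μ ν π)).comp
    ((ha.comp measurable_fst).prodMk (ha.comp measurable_snd))

/-- Integrals of block functions reduce to finite sums. -/
lemma lintegral_comp_prodMap (ha : Measurable a) (F : ι × ι → ℝ≥0∞) (ρ : Measure (X × X)) :
    ∫⁻ z, F (a z.1, a z.2) ∂ρ = ∑ w, F w * ρ ((a ⁻¹' {w.1}) ×ˢ (a ⁻¹' {w.2})) := by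
  have hm : Measurable fun z : X × X => (a z.1, a z.2) :=
    (ha.comp measurable_fst).prodMk (ha.comp measurable_snd)
  rw [← lintegral_map (f := F) .of_discrete hm, lintegral_fintype]
  refine Finset.sum_congr rfl fun w _ => ?_
  rw [Measure.map_apply hm (measurableSet_singleton w)]
  congr 2
  ext z
  simp [Prod.ext_iff]

lemma sum_measure_prod_fst (ha : Measurable a) (h1 : π.map Prod.fst = μ) (i : ι) :
    ∑ j, π ((a ⁻¹' {i}) ×ˢ (a ⁻¹' {j})) = μ (a ⁻¹' {i}) := by
  have hi := ha (measurableSet_singleton i)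
  rw [← h1, Measure.map_apply measurable_fst hi, ← measure_biUnion_finset]
  · congr 1
    ext z
    simp
  · intro j _ k _ hjk
    refine Set.disjoint_left.2 fun z hz hz' => hjk ?_
    exact hz.2.symm.trans hz'.2
  · exact fun j _ => hi.prod (ha (measurableSet_singleton j))

lemma ae_measure_fiber_ne_zero (ha : Measurable a) (μ : Measure X) :
    ∀ᵐ x ∂μ, μ (a ⁻¹' {a x}) ≠ 0 := by
  have h : ∀ᵐ i ∂(μ.map a), (μ.map a) {i} ≠ 0 := by
    have : ∀ᵐ i ∂(μ.map a), ∀ j : ι, (μ.map a) {j} = 0 → i ≠ j := by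
      rw [ae_all_iff]
      intro j
      by_cases hj : (μ.map a) {j} = 0
      · filter_upwards [compl_mem_ae_iff.2 hj] with i hi _ using hi
      · exact .of_forall fun i h => absurd h hj
    filter_upwards [this] with i hi h0 using hi i h0 rfl
  filter_upwards [ae_of_ae_map ha.aemeasurable h] with x hx
  rwa [Measure.map_apply ha (measurableSet_singleton _)] at hx

variable [IsFiniteMeasure μ] [IsFiniteMeasure ν]

lemma lintegral_blockRatio_snd (ha : Measurable a) (h1 : π.map Prod.fst = μ)
    (h2 : π.map Prod.snd = ν) {x : X} (hx : μ (a ⁻¹' {a x}) ≠ 0) :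
    ∫⁻ y, blockRatio a μ ν π (a x, a y) ∂ν = 1 := by
  rw [← lintegral_map (f := fun j => blockRatio a μ ν π (a x, j)) .of_discrete ha,
    lintegral_fintype]
  have hfin : μ (a ⁻¹' {a x}) ≠ ∞ := measure_ne_top _ _
  rw [← ENNReal.mul_right_inj hx hfin, mul_one, Finset.mul_sum,
    ← sum_measure_prod_fst ha h1 (a x)]
  refine Finset.sum_congr rfl fun j _ => ?_
  rw [sum_measure_prod_fst ha h1, Measure.map_apply ha (measurableSet_singleton j),
    ← blockRatio_mul ha h1 h2 (a x, j)]
  ring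

lemma map_fst_blockPlan (ha : Measurable a) (h1 : π.map Prod.fst = μ)
    (h2 : π.map Prod.snd = ν) : (blockPlan a μ ν π).map Prod.fst = μ := by
  ext B hB
  have hm := measurable_blockRatio_comp ha μ ν π
  rw [Measure.map_apply measurable_fst hB, blockPlan, withDensity_apply _ (measurable_fst hB),
    ← Set.prod_univ, ← Measure.prod_restrict, Measure.restrict_univ, lintegral_prod _ hm.aemeasurable]
  calc ∫⁻ x in B, ∫⁻ y, blockRatio a μ ν π (a x, a y) ∂ν ∂μ = ∫⁻ _ in B, 1 ∂μ :=
        lintegral_congr_ae (ae_restrict_of_ae ((ae_measure_fiber_ne_zero ha μ).mono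
          fun x hx => lintegral_blockRatio_snd ha h1 h2 hx))
    _ = μ B := by simp

lemma map_swap_blockPlan (ha : Measurable a) :
    (blockPlan a μ ν π).map Prod.swap = blockPlan a ν μ (π.map Prod.swap) := by
  ext B hB
  have hm := measurable_blockRatio_comp ha ν μ (π.map Prod.swap)
  rw [Measure.map_apply measurable_swap hB, blockPlan, blockPlan, withDensity_apply _ hB,
    withDensity_apply _ (measurable_swap hB), ← Measure.prod_swap (μ := μ),
    setLIntegral_map hB hm measurable_swap]
  exact lintegral_congr fun z => (blockRatio_swap (a z.1, a z.2)).symm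

lemma map_snd_blockPlan (ha : Measurable a) (h1 : π.map Prod.fst = μ)
    (h2 : π.map Prod.snd = ν) : (blockPlan a μ ν π).map Prod.snd = ν := by
  have h1' : (π.map Prod.swap).map Prod.fst = ν := by
    rwa [Measure.map_map measurable_fst measurable_swap]
  have h2' : (π.map Prod.swap).map Prod.snd = μ := by
    rwa [Measure.map_map measurable_snd measurable_swap]
  have h := map_fst_blockPlan ha h1' h2'
  rwa [← map_swap_blockPlan ha, Measure.map_map measurable_fst measurable_swap] at h

lemma map_prodMap_blockPlan (ha : Measurable a) (h1 : π.map Prod.fst = μ)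
    (h2 : π.map Prod.snd = ν) :
    (blockPlan a μ ν π).map (Prod.map a a) = π.map (Prod.map a a) := by
  have hm : Measurable (Prod.map a a) := ha.prodMap ha
  refine Measure.ext_of_singleton fun w => ?_
  have hs : Prod.map a a ⁻¹' {w} = (a ⁻¹' {w.1}) ×ˢ (a ⁻¹' {w.2}) := by
    ext z
    simp [Prod.ext_iff]
  have hsm := hm (measurableSet_singleton w)
  rw [Measure.map_apply hm (measurableSet_singleton w),
    Measure.map_apply hm (measurableSet_singleton w), blockPlan, withDensity_apply _ hsm,
    setLIntegral_congr_fun (g := fun _ => blockRatio a μ ν π w) hsm (fun z hz => ?_),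
    setLIntegral_const, hs, Measure.prod_prod, blockRatio_mul ha h1 h2]
  exact congrArg _ hz

lemma ofReal_klFun_toReal_le (x : ℝ≥0∞) :
    ENNReal.ofReal (InformationTheory.klFun x.toReal) ≤ x ^ 2 + 1 := by
  have key : ∀ t : ℝ, 0 ≤ t → InformationTheory.klFun t ≤ t ^ 2 + 1 := by
    intro t ht
    rw [InformationTheory.klFun_apply]
    rcases ht.eq_or_lt with rfl | h
    · simp
    -- log t ≤ t - 1 gives the bound (t - 1)².
    · nlinarith [mul_le_mul_of_nonneg_left (Real.log_le_sub_one_of_pos h) h.le]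
  induction x with
  | top => simp
  | coe t =>
    refine (ENNReal.ofReal_le_ofReal (key _ ENNReal.toReal_nonneg)).trans_eq ?_
    rw [ENNReal.ofReal_add (by positivity) zero_le_one, ENNReal.ofReal_pow (by positivity)]
    simp

/-- Each block contributes its squared π-mass divided by the product of its marginal masses. The
π-mass is at most either factor, so the contribution is at most 1, whatever μ, ν and π are. -/
lemma klDiv_blockPlan_le [IsProbabilityMeasure μ] [IsProbabilityMeasure ν] (ha : Measurable a)
    (h1 : π.map Prod.fst = μ) (h2 : π.map Prod.snd = ν)
    [IsFiniteMeasure (blockPlan a μ ν π)] :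
    InformationTheory.klDiv (blockPlan a μ ν π) (μ.prod ν) ≤ Fintype.card (ι × ι) + 1 := by
  have hm := measurable_blockRatio_comp ha μ ν π
  have hac : blockPlan a μ ν π ≪ μ.prod ν := withDensity_absolutelyContinuous _ _
  rw [InformationTheory.klDiv_eq_lintegral_klFun_of_ac hac]
  calc ∫⁻ z, ENNReal.ofReal (InformationTheory.klFun
          ((blockPlan a μ ν π).rnDeriv (μ.prod ν) z).toReal) ∂(μ.prod ν)
      ≤ ∫⁻ z, (blockRatio a μ ν π (a z.1, a z.2) ^ 2 + 1) ∂(μ.prod ν) := by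
        refine lintegral_mono_ae ?_
        filter_upwards [Measure.rnDeriv_withDensity (μ.prod ν) hm] with z hz
        rw [blockPlan, hz]
        exact ofReal_klFun_toReal_le _
    _ = ∑ w, blockRatio a μ ν π w ^ 2 * (μ (a ⁻¹' {w.1}) * ν (a ⁻¹' {w.2})) + 1 := by
        rw [lintegral_add_right _ measurable_const,
          lintegral_comp_prodMap ha (fun w => blockRatio a μ ν π w ^ 2)]
        simp [Measure.prod_prod]
    _ ≤ ∑ _w : ι × ι, 1 + 1 := by
        gcongr with w
        rw [pow_two, mul_assoc, blockRatio_mul ha h1 h2, blockRatio, ← ENNReal.mul_div_right_comm]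
        refine ENNReal.div_le_of_le_mul ?_
        rw [one_mul]
        exact mul_le_mul' (measure_prod_le_fst ha h1 _ _) (measure_prod_le_snd ha h2 _ _)
    _ = Fintype.card (ι × ι) + 1 := by simp

end BlockApproximation

/-! ### Comparison inequalities between the functionals -/

section Couplings

variable {X : Type*} [MeasurableSpace X]

lemma prod_mem_couplings (μ ν : ProbabilityMeasure X) : μ.prod ν ∈ couplings μ ν :=
  ⟨congrArg Subtype.val (ProbabilityMeasure.map_fst_prod μ ν),
    congrArg Subtype.val (ProbabilityMeasure.map_snd_prod μ ν)⟩

lemma diagonal_mem_couplings (μ : ProbabilityMeasure X) :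
    μ.map (f := fun x => (x, x)) (by fun_prop) ∈ couplings μ μ := by
  have h : Measurable fun x : X => (x, x) := by fun_prop
  constructor
  · rw [ProbabilityMeasure.toMeasure_map, Measure.map_map measurable_fst h]
    exact Measure.map_id
  · rw [ProbabilityMeasure.toMeasure_map, Measure.map_map measurable_snd h]
    exact Measure.map_id

variable {c : X × X → ℝ} {ε : ℝ} {μ ν : ProbabilityMeasure X}

lemma OT_le_of_mem {π : ProbabilityMeasure (X × X)} (hπ : π ∈ couplings μ ν) :
    OT c μ ν ≤ ((∫ z, c z ∂(π : Measure (X × X)) : ℝ) : EReal) :=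
  iInf₂_le π hπ

lemma OT_le_OTeps (hε : 0 ≤ ε) : OT c μ ν ≤ OTeps c ε μ ν :=
  le_iInf₂ fun _ hπ => (OT_le_of_mem hπ).trans
    (le_add_of_nonneg_right (mul_nonneg (EReal.coe_nonneg.2 hε) (EReal.coe_ennreal_nonneg _)))

lemma OTeps_le_OTinf : OTeps c ε μ ν ≤ OTinf c μ ν := by
  refine (iInf₂_le _ (prod_mem_couplings μ ν)).trans_eq ?_
  rw [ProbabilityMeasure.toMeasure_prod, InformationTheory.klDiv_self]
  simp [OTinf]

lemma le_OT_of_le {b : ℝ} (hint : ∀ π : ProbabilityMeasure (X × X), Integrable c π)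
    (hb : ∀ z, b ≤ c z) : (b : EReal) ≤ OT c μ ν := by
  refine le_iInf₂ fun π _ => EReal.coe_le_coe_iff.2 ?_
  simpa using integral_mono (integrable_const b) (hint π) hb

/-- Fenchel–Young: s ↦ exp s - 1 is the convex conjugate of `klFun`. -/
lemma sub_exp_le_klFun {t : ℝ} (ht : 0 ≤ t) (s : ℝ) :
    s * t - (Real.exp s - 1) ≤ InformationTheory.klFun t := by
  rw [InformationTheory.klFun_apply]
  rcases ht.eq_or_lt with rfl | h
  · simp [Real.exp_nonneg]
  · have h1 := Real.add_one_le_exp (s - Real.log t)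
    rw [Real.exp_sub, Real.exp_log h, le_div_iff₀ h] at h1
    linarith

/-- Fenchel–Young at s = -x/ε, with exp s - 1 ≤ s + s² for |s| ≤ 1; this is where C ≤ ε enters. -/
lemma sub_le_mul_add_mul_klFun {C x t : ℝ} (hx : |x| ≤ C) (ht : 0 ≤ t) (hε : 0 < ε)
    (hC : C ≤ ε) : x - C ^ 2 / ε ≤ t * x + ε * InformationTheory.klFun t := by
  have h1 := sub_exp_le_klFun ht (-x / ε)
  have hs : |-x / ε| ≤ 1 := by
    rw [abs_div, abs_neg, abs_of_pos hε, div_le_one hε]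
    exact hx.trans hC
  have h2 := (abs_le.1 (Real.abs_exp_sub_one_sub_id_le hs)).2
  have h3 : ε * (-x / ε * t - (-x / ε + (-x / ε) ^ 2)) ≤ ε * InformationTheory.klFun t :=
    mul_le_mul_of_nonneg_left (by linarith) hε.le
  have h4 : ε * (-x / ε * t - (-x / ε + (-x / ε) ^ 2)) = -x * t + x - x ^ 2 / ε := by
    field_simp
    ring
  have h5 : x ^ 2 / ε ≤ C ^ 2 / ε := by
    exact div_le_div_of_nonneg_right (sq_le_sq' (abs_le.1 hx).1 (abs_le.1 hx).2) hε.le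
  linarith

lemma OTinf_sub_le_OTeps {C : ℝ} (hint : ∀ π : ProbabilityMeasure (X × X), Integrable c π)
    (hc : ∀ z, |c z| ≤ C) (hε : 0 < ε) (hC : C ≤ ε) :
    OTinf c μ ν - ((C ^ 2 / ε : ℝ) : EReal) ≤ OTeps c ε μ ν := by
  refine le_iInf₂ fun π _ => ?_
  set ρ : Measure (X × X) := (μ : Measure X).prod (ν : Measure X)
  by_cases hk : InformationTheory.klDiv (π : Measure (X × X)) ρ = ⊤
  · rw [hk, EReal.coe_ennreal_top, EReal.coe_mul_top_of_pos hε, EReal.coe_add_top]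
    exact le_top
  obtain ⟨hac, hll⟩ := InformationTheory.klDiv_ne_top_iff.1 hk
  have hkl := (InformationTheory.integrable_klFun_rnDeriv_iff hac).2 hll
  have hρ : Integrable c ρ := hint (μ.prod ν)
  have hrn : Integrable (fun z => ((π : Measure (X × X)).rnDeriv ρ z).toReal * c z) ρ :=
    (integrable_rnDeriv_smul_iff hac).2 (hint π)
  rw [← EReal.coe_ennreal_toReal hk, InformationTheory.toReal_klDiv_eq_integral_klFun hac,
    ← integral_rnDeriv_smul hac, OTinf, ← EReal.coe_sub, ← EReal.coe_mul, ← EReal.coe_add,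
    EReal.coe_le_coe_iff]
  have h := integral_mono (hρ.sub (integrable_const (C ^ 2 / ε))) (hrn.add (hkl.const_mul ε))
    (fun z => sub_le_mul_add_mul_klFun (hc z) ENNReal.toReal_nonneg hε hC)
  simp only [Pi.add_apply, Pi.sub_apply] at h
  rw [integral_sub hρ (integrable_const _), integral_add hrn (hkl.const_mul ε),
    integral_const_mul] at h
  simpa using h

lemma Seps_le_OTeps (hint : ∀ π : ProbabilityMeasure (X × X), Integrable c π)
    (hc : ∀ z, 0 ≤ c z) (hε : 0 ≤ ε) : Seps c ε μ ν ≤ OTeps c ε μ ν := by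
  have h : ∀ μ : ProbabilityMeasure X, 0 ≤ ((1 / 2 : ℝ) : EReal) * OTeps c ε μ μ := fun μ =>
    mul_nonneg (EReal.coe_nonneg.2 (by norm_num)) ((le_OT_of_le hint hc).trans (OT_le_OTeps hε))
  calc Seps c ε μ ν ≤ OTeps c ε μ ν - 0 - 0 := EReal.sub_le_sub (EReal.sub_le_sub le_rfl (h _)) (h _)
    _ = OTeps c ε μ ν := by simp

lemma OTeps_sub_le_Seps {η : ℝ} (h : ∀ μ : ProbabilityMeasure X, OTeps c ε μ μ ≤ (η : EReal)) :
    OTeps c ε μ ν - (η : EReal) ≤ Seps c ε μ ν := by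
  have h' : ∀ μ : ProbabilityMeasure X,
      ((1 / 2 : ℝ) : EReal) * OTeps c ε μ μ ≤ ((η / 2 : ℝ) : EReal) := fun μ => by
    refine (mul_le_mul_of_nonneg_left (h μ) (EReal.coe_nonneg.2 (by norm_num))).trans_eq ?_
    rw [← EReal.coe_mul]
    congr 1
    ring
  refine le_trans (le_of_eq ?_) (EReal.sub_le_sub (EReal.sub_le_sub le_rfl (h' μ)) (h' ν))
  induction OTeps c ε μ ν with
  | bot => simp
  | top => simp
  | coe x =>
    norm_cast
    ring

end Couplings

/-! ### Weak compactness and the two limits -/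

section Compact

variable {X : Type*} [MetricSpace X] [CompactSpace X] [MeasurableSpace X] [BorelSpace X]
  {c : X × X → ℝ}

lemma integrable_of_continuous (hc : Continuous c) (π : ProbabilityMeasure (X × X)) :
    Integrable c (π : Measure (X × X)) :=
  (BoundedContinuousFunction.mkOfCompact ⟨c, hc⟩).integrable _

lemma isClosed_couplings_right (ν : ProbabilityMeasure X) :
    IsClosed {p : ProbabilityMeasure (X × X) × ProbabilityMeasure X | p.1 ∈ couplings p.2 ν} := by
  have h : {p : ProbabilityMeasure (X × X) × ProbabilityMeasure X | p.1 ∈ couplings p.2 ν} =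
      {p | p.1.map (continuous_fst (X := X) (Y := X)).measurable.aemeasurable = p.2} ∩
        {p | p.1.map (continuous_snd (X := X) (Y := X)).measurable.aemeasurable = ν} := by
    ext p
    exact and_congr (Subtype.ext_iff (a1 := p.1.map _)).symm
      (Subtype.ext_iff (a1 := p.1.map _)).symm
  rw [h]
  exact (isClosed_eq ((ProbabilityMeasure.continuous_map continuous_fst).comp continuous_fst)
    continuous_snd).inter (isClosed_eq
      ((ProbabilityMeasure.continuous_map continuous_snd).comp continuous_fst) continuous_const)

/-- The first marginals of plans with cost at most b' form the projection of a closed set along the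
compact space of plans, hence a closed set. No minimizer is needed. -/
lemma lowerSemicontinuous_OT (hc : Continuous c) (ν : ProbabilityMeasure X) :
    LowerSemicontinuous fun μ => OT c μ ν := by
  have hI : Continuous fun π : ProbabilityMeasure (X × X) => ∫ z, c z ∂(π : Measure (X × X)) :=
    ProbabilityMeasure.continuous_integral_continuousMap (⟨c, hc⟩ : C(X × X, ℝ))
  intro μ b hb
  obtain ⟨b', hb, hb'⟩ := exists_between hb
  have hcl : IsClosed (Prod.snd '' ({p : ProbabilityMeasure (X × X) × ProbabilityMeasure X |
      p.1 ∈ couplings p.2 ν} ∩ {p | ((∫ z, c z ∂(p.1 : Measure (X × X)) : ℝ) : EReal) ≤ b'})) :=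
    isClosedMap_snd_of_compactSpace _ ((isClosed_couplings_right ν).inter
      (isClosed_le (continuous_coe_real_ereal.comp (hI.comp continuous_fst)) continuous_const))
  have hμ : μ ∉ Prod.snd '' ({p : ProbabilityMeasure (X × X) × ProbabilityMeasure X |
      p.1 ∈ couplings p.2 ν} ∩ {p | ((∫ z, c z ∂(p.1 : Measure (X × X)) : ℝ) : EReal) ≤ b'}) := by
    rintro ⟨p, ⟨hp, hpb⟩, rfl⟩
    exact absurd ((OT_le_of_mem hp).trans hpb) (not_le.2 hb')
  filter_upwards [hcl.isOpen_compl.mem_nhds hμ] with μ' hμ'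
  refine hb.trans_le (le_iInf₂ fun π hπ => ?_)
  by_contra h
  exact hμ' ⟨(π, μ'), ⟨hπ, (not_le.1 h).le⟩, rfl⟩

lemma exists_measurable_fin_dist_le [Nonempty X] {r : ℝ} (hr : 0 < r) :
    ∃ (N : ℕ) (a : X → Fin N) (e : Fin N → X), Measurable a ∧ ∀ x, dist x (e (a x)) ≤ r := by
  obtain ⟨t, ht⟩ := isCompact_univ.elim_finite_subcover
    (fun k => Metric.ball (TopologicalSpace.denseSeq X k) r) (fun _ => Metric.isOpen_ball)
    (fun x _ => by
      obtain ⟨k, hk⟩ := (TopologicalSpace.denseRange_denseSeq X).exists_dist_lt x hr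
      exact Set.mem_iUnion.2 ⟨k, hk⟩)
  set e := TopologicalSpace.denseSeq X
  set N := t.sup id
  have hlt : ∀ x, SimpleFunc.nearestPtInd e N x < N + 1 := fun x =>
    Nat.lt_succ_of_le (SimpleFunc.nearestPtInd_le e N x)
  refine ⟨N + 1, fun x => ⟨SimpleFunc.nearestPtInd e N x, hlt x⟩, fun i => e i, ?_, fun x => ?_⟩
  · have h : Measurable ((fun n : ℕ => Fin.ofNat (N + 1) n) ∘ SimpleFunc.nearestPtInd e N) :=
      Measurable.of_discrete.comp (SimpleFunc.measurable _)
    convert h using 1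
    ext x
    simp [Nat.mod_eq_of_lt (hlt x)]
  · obtain ⟨k, hk, hx⟩ := Set.mem_iUnion₂.1 (ht (Set.mem_univ x))
    have h := SimpleFunc.edist_nearestPt_le e x (Finset.le_sup (f := id) hk : k ≤ N)
    rw [edist_dist, edist_dist, ENNReal.ofReal_le_ofReal_iff dist_nonneg] at h
    rw [dist_comm]
    exact h.trans (Metric.mem_ball'.1 hx).le

/-- Any coupling is approximated, uniformly in the marginals, by couplings of bounded entropy. -/
lemma exists_forall_OTeps_le (hc : ∃ L : NNReal, LipschitzWith L c) {η : ℝ} (hη : 0 < η) :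
    ∃ ε₀ > 0, ∀ ε, 0 < ε → ε < ε₀ → ∀ (μ ν : ProbabilityMeasure X), ∀ π ∈ couplings μ ν,
      OTeps c ε μ ν ≤ ((∫ z, c z ∂(π : Measure (X × X)) + η : ℝ) : EReal) := by
  obtain ⟨L, hL⟩ := hc
  rcases isEmpty_or_nonempty X with hX | hX
  · exact ⟨1, one_pos, fun ε _ _ μ => (μ.nonempty.elim fun x => hX.elim x)⟩
  obtain ⟨r, hr, hLr⟩ : ∃ r > 0, (L : ℝ) * r ≤ η / 4 :=
    -- L + 1 keeps the denominator positive when L = 0.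
    ⟨η / (4 * (L + 1)), by positivity, by
      rw [mul_div_assoc', div_le_div_iff₀ (by positivity) (by norm_num)]
      nlinarith [L.coe_nonneg]⟩
  obtain ⟨N, a, e, ha, hae⟩ := exists_measurable_fin_dist_le (X := X) hr
  set K : ℝ := (N * N : ℕ) + 1
  have hK : 0 < K := by positivity
  -- Error budget: η/2 for the entropy, and η/4 for discretizing the cost under each of the two
  -- plans.
  refine ⟨η / (2 * K), by positivity, fun ε hε hε₀ μ ν π hπ => ?_⟩
  have hfst := map_fst_blockPlan ha hπ.1 hπ.2
  have hprob : IsProbabilityMeasure (blockPlan a (μ : Measure X) ν (π : Measure (X × X))) := by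
    constructor
    rw [← Set.preimage_univ (f := Prod.fst), ← Measure.map_apply measurable_fst .univ, hfst,
      measure_univ]
  set π' : ProbabilityMeasure (X × X) := ⟨blockPlan a (μ : Measure X) ν (π : Measure (X × X)), hprob⟩
  have hπ' : π' ∈ couplings μ ν := ⟨hfst, map_snd_blockPlan ha hπ.1 hπ.2⟩
  have hkl : ((InformationTheory.klDiv (π' : Measure (X × X))
      ((μ : Measure X).prod (ν : Measure X)) : ENNReal) : EReal) ≤ (K : EReal) := by
    refine (EReal.coe_ennreal_le_coe_ennreal_iff.2
      (klDiv_blockPlan_le ha hπ.1 hπ.2)).trans_eq ?_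
    simp only [K, Fintype.card_prod, Fintype.card_fin]
    norm_cast
  set q : X × X → X × X := fun z => (e (a z.1), e (a z.2))
  have hq : ∀ z, |c z - c (q z)| ≤ η / 4 := fun z => by
    rw [← Real.dist_eq]
    exact ((hL.dist_le_mul _ _).trans
      (mul_le_mul_of_nonneg_left (max_le (hae z.1) (hae z.2)) L.coe_nonneg)).trans hLr
  have hcint := integrable_of_continuous hL.continuous
  have hqint : ∀ σ : ProbabilityMeasure (X × X), Integrable (fun z => c (q z)) σ := fun σ =>
    Integrable.of_finite.comp_measurable (g := fun w : Fin N × Fin N => c (e w.1, e w.2))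
      (ha.prodMap ha)
  have hdiff : ∀ σ : ProbabilityMeasure (X × X),
      |∫ z, c z ∂(σ : Measure (X × X)) - ∫ z, c (q z) ∂(σ : Measure (X × X))| ≤ η / 4 := fun σ => by
    rw [← integral_sub (hcint σ) (hqint σ)]
    simpa using norm_integral_le_of_norm_le_const (μ := (σ : Measure (X × X)))
      (f := fun z => c z - c (q z)) (.of_forall hq)
  -- The discretized cost sees only cell indices, whose joint law is the same under both plans.
  have heq : ∫ z, c (q z) ∂(π' : Measure (X × X)) = ∫ z, c (q z) ∂(π : Measure (X × X)) := by
    have h : ∀ σ : Measure (X × X), ∫ z, c (q z) ∂σ =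
        ∫ w, c (e w.1, e w.2) ∂(σ.map (Prod.map a a)) := fun σ =>
      (integral_map (ha.prodMap ha).aemeasurable
        (Measurable.of_discrete (f := fun w : Fin N × Fin N =>
          c (e w.1, e w.2))).aestronglyMeasurable).symm
    rw [h, h]
    exact congrArg (fun σ => ∫ w, c (e w.1, e w.2) ∂σ) (map_prodMap_blockPlan ha hπ.1 hπ.2)
  refine (iInf₂_le π' hπ').trans ?_
  refine (add_le_add_right (mul_le_mul_of_nonneg_left hkl (EReal.coe_nonneg.2 hε.le)) _).trans ?_
  rw [← EReal.coe_mul, ← EReal.coe_add, EReal.coe_le_coe_iff]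
  have h1 := abs_le.1 (hdiff π)
  have h2 := abs_le.1 (hdiff π')
  have h3 : ε * K ≤ η / 2 := by
    rw [lt_div_iff₀ (by positivity)] at hε₀
    linarith
  linarith [h1.1, h2.2]

lemma exists_forall_OTeps_self_le (hc : ∃ L : NNReal, LipschitzWith L c)
    (hdiag : ∀ x, c (x, x) = 0) {η : ℝ} (hη : 0 < η) :
    ∃ ε₀ > 0, ∀ ε, 0 < ε → ε < ε₀ → ∀ μ : ProbabilityMeasure X, OTeps c ε μ μ ≤ (η : EReal) := by
  obtain ⟨ε₀, hε₀, h⟩ := exists_forall_OTeps_le hc hη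
  obtain ⟨L, hL⟩ := hc
  refine ⟨ε₀, hε₀, fun ε hε hlt μ => (h ε hε hlt μ μ _ (diagonal_mem_couplings μ)).trans_eq ?_⟩
  rw [ProbabilityMeasure.toMeasure_map,
    integral_map (by fun_prop) hL.continuous.aestronglyMeasurable]
  simp [hdiag]

lemma tendsto_OTeps_atTop (hc : Continuous c) {ε : ℕ → ℝ} (hε : Tendsto ε atTop atTop)
    {p q : ℕ → ProbabilityMeasure X} {μ ν : ProbabilityMeasure X} (hp : Tendsto p atTop (𝓝 μ))
    (hq : Tendsto q atTop (𝓝 ν)) :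
    Tendsto (fun n => OTeps c (ε n) (p n) (q n)) atTop (𝓝 (OTinf c μ ν)) := by
  obtain ⟨C, hC⟩ := isCompact_univ.exists_bound_of_continuousOn (hc.continuousOn (s := Set.univ))
  have hI : Continuous fun π : ProbabilityMeasure (X × X) => ∫ z, c z ∂(π : Measure (X × X)) :=
    ProbabilityMeasure.continuous_integral_continuousMap (⟨c, hc⟩ : C(X × X, ℝ))
  have hlim : Tendsto (fun n => ∫ z, c z ∂((p n : Measure X).prod (q n : Measure X))) atTop
      (𝓝 (∫ z, c z ∂((μ : Measure X).prod (ν : Measure X)))) :=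
    ((hI.comp ProbabilityMeasure.continuous_prod).tendsto (μ, ν)).comp (hp.prodMk_nhds hq)
  have hlow : Tendsto (fun n => ∫ z, c z ∂((p n : Measure X).prod (q n : Measure X)) - C ^ 2 / ε n)
      atTop (𝓝 (∫ z, c z ∂((μ : Measure X).prod (ν : Measure X)))) := by
    simpa using hlim.sub (hε.const_div_atTop (C ^ 2))
  refine tendsto_of_tendsto_of_tendsto_of_le_of_le' (EReal.tendsto_coe.2 hlow)
    (EReal.tendsto_coe.2 hlim) ?_ (.of_forall fun n => OTeps_le_OTinf)
  filter_upwards [hε.eventually_gt_atTop 0, hε.eventually_ge_atTop C] with n h0 hCn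
  rw [EReal.coe_sub]
  exact OTinf_sub_le_OTeps (integrable_of_continuous hc) (fun z => hC z trivial) h0 hCn

lemma tendsto_Seps_atTop (hc : Continuous c) {ε : ℕ → ℝ} (hε : Tendsto ε atTop atTop)
    {p : ℕ → ProbabilityMeasure X} {μ : ProbabilityMeasure X} (hp : Tendsto p atTop (𝓝 μ))
    (ν : ProbabilityMeasure X) :
    Tendsto (fun n => Seps c (ε n) (p n) ν) atTop (𝓝 (Sinf c μ ν)) := by
  have hν : Tendsto (fun _ : ℕ => ν) atTop (𝓝 ν) := tendsto_const_nhds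
  -- All limits are real, so `EReal` addition is continuous there.
  have hsub : ∀ {f g : ℕ → EReal} {x y : ℝ}, Tendsto f atTop (𝓝 (x : EReal)) →
      Tendsto g atTop (𝓝 (y : EReal)) →
      Tendsto (fun n => f n - ((1 / 2 : ℝ) : EReal) * g n) atTop
        (𝓝 ((x - 1 / 2 * y : ℝ) : EReal)) := by
    intro f g x y hf hg
    have hg' := EReal.Tendsto.const_mul hg (.inl (EReal.coe_ne_bot (1 / 2)))
      (.inl (EReal.coe_ne_top (1 / 2)))
    rw [← EReal.coe_mul] at hg'
    have hg'' := (continuous_neg.tendsto _).comp hg'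
    rw [← EReal.coe_neg] at hg''
    have := (EReal.continuousAt_add_coe_coe x (-(1 / 2 * y))).tendsto.comp (hf.prodMk_nhds hg'')
    rw [← EReal.coe_add] at this
    exact this
  exact hsub (hsub (tendsto_OTeps_atTop hc hε hp hν) (tendsto_OTeps_atTop hc hε hp hp))
    (tendsto_OTeps_atTop hc hε hν hν)

lemma limsup_OTeps_le_OT (hc : ∃ L : NNReal, LipschitzWith L c) {ε : ℕ → ℝ} (hε : ∀ n, 0 < ε n)
    (hε0 : Tendsto ε atTop (𝓝 0)) (μ ν : ProbabilityMeasure X) :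
    limsup (fun n => OTeps c (ε n) μ ν) atTop ≤ OT c μ ν := by
  refine le_iInf₂ fun π hπ => EReal.le_of_forall_lt_iff_le.1 fun b hb => ?_
  rw [EReal.coe_lt_coe_iff] at hb
  obtain ⟨ε₀, hε₀, h⟩ := exists_forall_OTeps_le hc (sub_pos.2 hb)
  refine limsup_le_of_le (h := ?_)
  filter_upwards [hε0.eventually_lt_const hε₀] with n hn
  simpa using h (ε n) (hε n) hn μ ν π hπ

lemma OT_le_liminf_Seps (hc : ∃ L : NNReal, LipschitzWith L c) (hdiag : ∀ x, c (x, x) = 0)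
    {ε : ℕ → ℝ} (hε : ∀ n, 0 < ε n) (hε0 : Tendsto ε atTop (𝓝 0))
    {p : ℕ → ProbabilityMeasure X} {μ : ProbabilityMeasure X} (hp : Tendsto p atTop (𝓝 μ))
    (ν : ProbabilityMeasure X) :
    OT c μ ν ≤ liminf (fun n => Seps c (ε n) (p n) ν) atTop := by
  refine EReal.ge_of_forall_gt_iff_ge.1 fun b hb => ?_
  obtain ⟨b', hb, hb'⟩ := EReal.lt_iff_exists_real_btwn.1 hb
  rw [EReal.coe_lt_coe_iff] at hb
  -- The gap b' - b absorbs both self-terms.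
  obtain ⟨ε₀, hε₀, h⟩ := exists_forall_OTeps_self_le hc hdiag (sub_pos.2 hb)
  obtain ⟨L, hL⟩ := hc
  refine le_liminf_of_le (h := ?_)
  filter_upwards [hε0.eventually_lt_const hε₀,
    hp.eventually (lowerSemicontinuous_OT hL.continuous ν μ _ hb')] with n hn hlt
  refine le_trans ?_ (OTeps_sub_le_Seps (h (ε n) (hε n) hn))
  refine le_trans ?_ (EReal.sub_le_sub (hlt.le.trans (OT_le_OTeps (hε n).le)) le_rfl)
  rw [← EReal.coe_sub]
  simp

end Compact

end SinkhornGamma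

theorem mainTheorem3 {X : Type*} [MetricSpace X] [CompactSpace X] [MeasurableSpace X]
    [BorelSpace X] (c : X × X → ℝ)
    (hc_symm : ∀ x y : X, c (x, y) = c (y, x))
    (hc_lip : ∃ L : NNReal, LipschitzWith L c)
    (ν : ProbabilityMeasure X) :
    (∀ ε : ℕ → ℝ, (∀ n, 0 < ε n) → Tendsto ε atTop atTop →
      SinkhornGamma.GammaConverges (fun n μ => SinkhornGamma.Seps c (ε n) μ ν)
        (fun μ => SinkhornGamma.Sinf c μ ν)) ∧
    ((∀ z : X × X, 0 ≤ c z) → (∀ x : X, c (x, x) = 0) →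
      ∀ ε : ℕ → ℝ, (∀ n, 0 < ε n) → Tendsto ε atTop (𝓝 0) →
        SinkhornGamma.GammaConverges (fun n μ => SinkhornGamma.Seps c (ε n) μ ν)
          (fun μ => SinkhornGamma.OT c μ ν)) := by
  obtain ⟨L, hL⟩ := id hc_lip
  refine ⟨fun ε _ hε p => ⟨fun q hq => ?_, fun _ => p, tendsto_const_nhds, ?_⟩,
    fun hc hdiag ε hpos hε p => ⟨fun q hq => ?_, fun _ => p, tendsto_const_nhds, ?_⟩⟩
  · exact (SinkhornGamma.tendsto_Seps_atTop hL.continuous hε hq ν).liminf_eq.ge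
  · exact (SinkhornGamma.tendsto_Seps_atTop hL.continuous hε tendsto_const_nhds ν).limsup_eq.le
  · exact SinkhornGamma.OT_le_liminf_Seps hc_lip hdiag hpos hε hq ν
  · exact (limsup_le_limsup (.of_forall fun n => SinkhornGamma.Seps_le_OTeps
      (SinkhornGamma.integrable_of_continuous hL.continuous) hc (hpos n).le)).trans
      (SinkhornGamma.limsup_OTeps_le_OT hc_lip hpos hε p ν)
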